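/- Let $X$ be a Banach space over $\mathbb{K}=\mathbb{R}$ or $\mathbb{C}$, let $\mathcal{L}(X)$ be the algebra of bounded linear operators on $X$ and $\mathcal{K}(X)$ its closed ideal of compact operators, and let the Calkin algebra $\mathcal{L}(X)/\mathcal{K}(X)$ carry the quotient norm $\|T+\mathcal{K}(X)\|=\inf\{\|T-K\| : K\in\mathcal{K}(X)\}$. Let $\ell_1(\mathbb{N}_0)$ be the Banach algebra of absolutely summable sequences $(a_n)_{n\ge 0}$ in $\mathbb{K}$ with norm $\sum_n |a_n|$ and the convolution product $(a*b)(m)=\sum_{j=0}^m a_j b_{m-j}$. Suppose that $\mathcal{L}(X)/\mathcal{K}(X)$ is isomorphic as a Banach algebra to $\ell_1(\mathbb{N}_0)$, i.e. that there is a $\mathbb{K}$-algebra isomorphism between them which is continuous together with its inverse. Then the strictly singular and the compact operators on $X$ coincide: a bounded linear operator $T\colon X\to X$ is strictly singular if and only if it is compact. Here $T$ is called strictly singular if every linear subspace $Z\subseteq X$ for which there is $\delta>0$ with $\|Tz\|\ge\delta\|z\|$ for all $z\in Z$ is finite dimensional. -/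

import Mathlib

noncomputable section

/-! ### Strictly singular operators -/

/-- A bounded operator `T : X → Y` is strictly singular if every subspace `Z` of `X` on which
`‖T z‖ ≥ δ ‖z‖` holds for some `δ > 0` is finite dimensional. -/
def IsStrictlySingular {𝕜 X Y : Type*} [RCLike 𝕜] [NormedAddCommGroup X] [NormedSpace 𝕜 X]
    [NormedAddCommGroup Y] [NormedSpace 𝕜 Y] (T : X →L[𝕜] Y) : Prop :=
  ∀ Z : Submodule 𝕜 X, (∃ δ : ℝ, 0 < δ ∧ ∀ z ∈ Z, δ * ‖z‖ ≤ ‖T z‖) → FiniteDimensional 𝕜 Z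

/-! ### The Calkin algebra -/

section Calkin

variable (𝕜 X : Type*) [RCLike 𝕜] [NormedAddCommGroup X] [NormedSpace 𝕜 X]

/-- The ideal `K(X)` of compact operators in the algebra `L(X)` of bounded operators. -/
def compactIdeal : Ideal (X →L[𝕜] X) where
  carrier := {T | IsCompactOperator T}
  add_mem' hS hT := IsCompactOperator.add hS hT
  zero_mem' := isCompactOperator_zero
  smul_mem' S _ hT := IsCompactOperator.clm_comp hT S

theorem mem_compactIdeal {T : X →L[𝕜] X} : T ∈ compactIdeal 𝕜 X ↔ IsCompactOperator T :=
  Iff.rfl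

instance compactIdeal_isTwoSided : (compactIdeal 𝕜 X).IsTwoSided :=
  ⟨fun S hT => IsCompactOperator.comp_clm hT S⟩

instance compactIdeal_isClosed [CompleteSpace X] :
    IsClosed (compactIdeal 𝕜 X : Set (X →L[𝕜] X)) :=
  isClosed_setOfPred_isCompactOperator

/-- The Calkin algebra `L(X) / K(X)`. Its ring and algebra structures are those of the quotient
by a two-sided ideal; its norm is the quotient norm `‖T + K(X)‖ = inf {‖T - K‖ : K ∈ K(X)}`. -/
abbrev CalkinAlgebra : Type _ := (X →L[𝕜] X) ⧸ compactIdeal 𝕜 X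

theorem CalkinAlgebra.norm_mul_le (x y : CalkinAlgebra 𝕜 X) : ‖x * y‖ ≤ ‖x‖ * ‖y‖ := by
  have key : ∀ ε : ℝ, 0 < ε → ‖x * y‖ ≤ (‖x‖ + ε) * (‖y‖ + ε) := by
    intro ε hε
    obtain ⟨a, rfl, ha⟩ := Submodule.Quotient.norm_mk_lt x hε
    obtain ⟨b, rfl, hb⟩ := Submodule.Quotient.norm_mk_lt y hε
    calc _ ≤ ‖a * b‖ := Submodule.Quotient.norm_mk_le (compactIdeal 𝕜 X) (a * b)
      _ ≤ ‖a‖ * ‖b‖ := _root_.norm_mul_le a b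
      _ ≤ _ := by gcongr
  have hlim : Filter.Tendsto (fun ε : ℝ => (‖x‖ + ε) * (‖y‖ + ε)) (nhdsWithin 0 (Set.Ioi 0))
      (nhds (‖x‖ * ‖y‖)) := by
    have : Continuous fun ε : ℝ => (‖x‖ + ε) * (‖y‖ + ε) := by fun_prop
    simpa using (this.tendsto 0).mono_left nhdsWithin_le_nhds
  exact ge_of_tendsto hlim (eventually_nhdsWithin_of_forall key)

instance CalkinAlgebra.normedRing [CompleteSpace X] : NormedRing (CalkinAlgebra 𝕜 X) :=
  { Submodule.Quotient.normedAddCommGroup (compactIdeal 𝕜 X),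
    Ideal.Quotient.ring (compactIdeal 𝕜 X) with
    norm_mul_le := CalkinAlgebra.norm_mul_le 𝕜 X }

instance CalkinAlgebra.normedAlgebra [CompleteSpace X] : NormedAlgebra 𝕜 (CalkinAlgebra 𝕜 X) :=
  { Ideal.Quotient.algebra 𝕜 with
    norm_smul_le := (Submodule.Quotient.normedSpace (compactIdeal 𝕜 X) 𝕜).norm_smul_le }

end Calkin

/-! ### The convolution algebra `ℓ₁(ℕ₀)` -/

/-- The Banach space `ℓ₁(ℕ₀)`, to be equipped with the convolution product. -/
def ConvL1 (𝕜 : Type*) [RCLike 𝕜] : Type _ := lp (fun _ : ℕ => 𝕜) 1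

namespace ConvL1

variable {𝕜 : Type*} [RCLike 𝕜]

instance : NormedAddCommGroup (ConvL1 𝕜) :=
  inferInstanceAs (NormedAddCommGroup (lp (fun _ : ℕ => 𝕜) 1))

instance : NormedSpace 𝕜 (ConvL1 𝕜) :=
  inferInstanceAs (NormedSpace 𝕜 (lp (fun _ : ℕ => 𝕜) 1))

instance : CompleteSpace (ConvL1 𝕜) :=
  inferInstanceAs (CompleteSpace (lp (fun _ : ℕ => 𝕜) 1))

/-- The `n`-th coordinate of an element of `ℓ₁(ℕ₀)`. -/
def coord (a : ConvL1 𝕜) (n : ℕ) : 𝕜 := a.1 n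

@[ext] theorem ext {a b : ConvL1 𝕜} (h : ∀ n, a.coord n = b.coord n) : a = b :=
  Subtype.ext (funext h)

theorem summable_norm (a : ConvL1 𝕜) : Summable fun n => ‖a.coord n‖ := by
  have h := (memℓp_gen_iff (p := 1) (by simp)).1 a.2
  simp only [ENNReal.toReal_one, Real.rpow_one] at h
  exact h

theorem norm_eq (a : ConvL1 𝕜) : ‖a‖ = ∑' n, ‖a.coord n‖ := by
  have h := lp.norm_eq_tsum_rpow (p := 1) (by simp) (show lp (fun _ : ℕ => 𝕜) 1 from a)
  simp only [ENNReal.toReal_one, Real.rpow_one, div_one] at h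
  exact h

/-- An absolutely summable sequence as an element of `ℓ₁(ℕ₀)`. -/
def ofSummable (f : ℕ → 𝕜) (hf : Summable fun n => ‖f n‖) : ConvL1 𝕜 :=
  ⟨f, memℓp_gen (by simpa using hf)⟩

@[simp] theorem coord_ofSummable (f : ℕ → 𝕜) (hf : Summable fun n => ‖f n‖) (n : ℕ) :
    (ofSummable f hf).coord n = f n := rfl

@[simp] theorem coord_zero (n : ℕ) : (0 : ConvL1 𝕜).coord n = 0 := rfl

@[simp] theorem coord_add (a b : ConvL1 𝕜) (n : ℕ) :
    (a + b).coord n = a.coord n + b.coord n := rfl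

@[simp] theorem coord_smul (c : 𝕜) (a : ConvL1 𝕜) (n : ℕ) :
    (c • a).coord n = c * a.coord n := rfl

/-- The convolution product `(a * b) m = ∑_{j=0}^m a_j b_{m-j}`. -/
instance : Mul (ConvL1 𝕜) where
  mul a b := ofSummable (fun m => ∑ j ∈ Finset.range (m + 1), a.coord j * b.coord (m - j))
    (summable_norm_sum_mul_range_of_summable_norm a.summable_norm b.summable_norm)

/-- The unit `(1, 0, 0, …)`. -/
instance : One (ConvL1 𝕜) where
  one := ofSummable (fun n => if n = 0 then 1 else 0)
    (summable_of_ne_finset_zero (s := {0}) (by simp +contextual))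

theorem coord_mul (a b : ConvL1 𝕜) (m : ℕ) :
    (a * b).coord m = ∑ j ∈ Finset.range (m + 1), a.coord j * b.coord (m - j) := rfl

theorem coord_one (n : ℕ) : (1 : ConvL1 𝕜).coord n = if n = 0 then 1 else 0 := rfl

theorem mk_coord_mul (a b : ConvL1 𝕜) :
    PowerSeries.mk (a * b).coord = PowerSeries.mk a.coord * PowerSeries.mk b.coord := by
  ext m
  simp [PowerSeries.coeff_mul, coord_mul,
    Finset.Nat.sum_antidiagonal_eq_sum_range_succ fun i j => a.coord i * b.coord j]

theorem mk_coord_one : PowerSeries.mk (1 : ConvL1 𝕜).coord = 1 := by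
  ext m
  simp [PowerSeries.coeff_one, coord_one]

theorem mk_coord_add (a b : ConvL1 𝕜) :
    PowerSeries.mk (a + b).coord = PowerSeries.mk a.coord + PowerSeries.mk b.coord := by
  ext m
  simp

theorem mk_coord_zero : PowerSeries.mk (0 : ConvL1 𝕜).coord = 0 := by
  ext m
  simp

theorem mk_coord_injective {a b : ConvL1 𝕜}
    (h : PowerSeries.mk a.coord = PowerSeries.mk b.coord) : a = b := by
  ext n
  simpa using congrArg (PowerSeries.coeff n) h

protected theorem norm_mul_le (a b : ConvL1 𝕜) : ‖a * b‖ ≤ ‖a‖ * ‖b‖ := by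
  have ha : Summable fun n => ‖‖a.coord n‖‖ := by simpa using a.summable_norm
  have hb : Summable fun n => ‖‖b.coord n‖‖ := by simpa using b.summable_norm
  have hs := (summable_norm_sum_mul_range_of_summable_norm ha hb).of_norm
  rw [norm_eq, norm_eq, norm_eq, tsum_mul_tsum_eq_tsum_sum_range_of_summable_norm ha hb]
  refine (a * b).summable_norm.tsum_le_tsum (fun n => ?_) hs
  rw [coord_mul]
  refine (norm_sum_le _ _).trans (le_of_eq ?_)
  simp

instance : NormedCommRing (ConvL1 𝕜) :=
  { (inferInstance : NormedAddCommGroup (ConvL1 𝕜)) with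
    mul := (· * ·)
    one := 1
    mul_assoc := fun a b c => mk_coord_injective (by simp only [mk_coord_mul, mul_assoc])
    one_mul := fun a => mk_coord_injective (by simp only [mk_coord_mul, mk_coord_one, one_mul])
    mul_one := fun a => mk_coord_injective (by simp only [mk_coord_mul, mk_coord_one, mul_one])
    left_distrib := fun a b c =>
      mk_coord_injective (by simp only [mk_coord_mul, mk_coord_add, mul_add])
    right_distrib := fun a b c =>
      mk_coord_injective (by simp only [mk_coord_mul, mk_coord_add, add_mul])
    zero_mul := fun a =>
      mk_coord_injective (by simp only [mk_coord_mul, mk_coord_zero, zero_mul])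
    mul_zero := fun a =>
      mk_coord_injective (by simp only [mk_coord_mul, mk_coord_zero, mul_zero])
    mul_comm := fun a b => mk_coord_injective (by simp only [mk_coord_mul, mul_comm])
    norm_mul_le := ConvL1.norm_mul_le }

instance : NormedAlgebra 𝕜 (ConvL1 𝕜) :=
  { Algebra.ofModule
      (fun c a b => by
        ext n
        simp [coord_mul, Finset.mul_sum, mul_assoc])
      (fun c a b => by
        ext n
        simp [coord_mul, Finset.mul_sum, mul_left_comm]) with
    norm_smul_le := norm_smul_le }

end ConvL1

end

/-! Riesz's lemma gives compact ⇒ strictly singular. Conversely, for strictly singular `S` every `1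
- t S` becomes a unit modulo compacts. Carried to `ℓ₁(ℕ₀)`, this concerns some `a` with all `1 - t
a` invertible. Evaluating power series at a point `x` of the closed unit disc is multiplicative, so
`a(x) ≠ 0` would contradict invertibility at `t = a(x)⁻¹`. Hence `a` vanishes on the disc, all its
coefficients are zero, and `S` is compact.

The unit property is an index-zero argument without the index. If `1 - t S` were not bounded below
on any closed subspace of finite codimension, it would be small on an infinite-dimensional subspace,
where `S` would then be bounded below (`IsStrictlySingular.exists_coFG_bddBelow`). Such
semi-Fredholm operators stay in the set of compact perturbations of invertibles under limits
(`mem_unitsAddCompact_of_mem_closure`), so the good `t` form a clopen set containing `0`, hence all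
of `𝕜`. -/

/-! ### Strictly singular operators and lower bounds in finite codimension -/

section StrictlySingular

variable {𝕜 X Y : Type*} [RCLike 𝕜] [NormedAddCommGroup X] [NormedSpace 𝕜 X]
  [NormedAddCommGroup Y] [NormedSpace 𝕜 Y]

/-- Compact operators are strictly singular. -/
theorem IsCompactOperator.isStrictlySingular {T : X →L[𝕜] Y} (hT : IsCompactOperator T) :
    IsStrictlySingular T := by
  rintro Z ⟨δ, hδ, hZ⟩
  by_contra hfin
  -- Riesz: a bounded 1-separated sequence in `Z`. Its images are δ-separated, so they have no
  -- convergent subsequence.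
  obtain ⟨R, f, -, hfR, hf⟩ := exists_seq_norm_le_one_le_norm_sub (𝕜 := 𝕜) hfin
  obtain ⟨K, hK, hKR⟩ := hT.image_closedBall_subset_compact R
  have hmem : ∀ n, T (f n) ∈ K := fun n =>
    hKR ⟨f n, by simpa using hfR n, rfl⟩
  obtain ⟨y, -, ψ, hψ, hy⟩ := hK.tendsto_subseq hmem
  obtain ⟨N, hN⟩ := Metric.cauchySeq_iff'.1 hy.cauchySeq δ hδ
  have h1 := hN (N + 1) (Nat.le_succ N)
  have h2 : 1 ≤ ‖f (ψ (N + 1)) - f (ψ N)‖ := hf (hψ (Nat.lt_succ_self N)).ne'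
  have h3 := hZ _ (f (ψ (N + 1)) - f (ψ N)).2
  simp only [Function.comp_apply, dist_eq_norm] at h1
  rw [Submodule.coe_norm] at h2
  simp only [Submodule.coe_sub, map_sub] at h2 h3
  nlinarith

/-- Coefficient bound for a triangular system of unit vectors and functionals. -/
theorem norm_coeff_le_of_triangular {x : ℕ → X} {f : ℕ → StrongDual 𝕜 X}
    (hx : ∀ n, ‖x n‖ ≤ 1) (hf : ∀ n, ‖f n‖ ≤ 1) (hfx : ∀ n, f n (x n) = 1)
    (hlt : ∀ m n, m < n → f m (x n) = 0) (a : ℕ → 𝕜) (N k : ℕ) (hk : k < N) :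
    ‖a k‖ ≤ 2 ^ k * ‖∑ j ∈ Finset.range N, a j • x j‖ := by
  set z := ∑ j ∈ Finset.range N, a j • x j with hz
  induction k using Nat.strong_induction_on with
  | _ k ih =>
  have hfz : f k z = (∑ j ∈ Finset.range k, a j * f k (x j)) + a k := by
    have hsub : Finset.range (k + 1) ⊆ Finset.range N := Finset.range_subset_range.2 hk
    rw [hz, map_sum, ← Finset.sum_subset hsub, Finset.sum_range_succ]
    · simp [hfx]
    · intro j _ hj
      rw [Finset.mem_range, not_lt] at hj
      simp [hlt k j hj]
  have hle : ∀ j, ‖f k (x j)‖ ≤ 1 := fun j =>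
    ((f k).le_opNorm _).trans (mul_le_one₀ (hf k) (norm_nonneg _) (hx j))
  have hsum : ‖∑ j ∈ Finset.range k, a j * f k (x j)‖ ≤ (2 ^ k - 1) * ‖z‖ := by
    calc _ ≤ ∑ j ∈ Finset.range k, 2 ^ j * ‖z‖ := by
          refine norm_sum_le_of_le _ fun j hj => ?_
          rw [Finset.mem_range] at hj
          rw [norm_mul]
          exact (mul_le_of_le_one_right (norm_nonneg _) (hle j)).trans (ih j hj (hj.trans hk))
      _ = _ := by
          rw [← Finset.sum_mul, geom_sum_eq (by norm_num)]
          norm_num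
  have hfz' : ‖f k z‖ ≤ ‖z‖ :=
    ((f k).le_opNorm _).trans (mul_le_of_le_one_left (norm_nonneg _) (hf k))
  calc ‖a k‖ = ‖f k z - ∑ j ∈ Finset.range k, a j * f k (x j)‖ := by rw [hfz]; congr 1; ring
    _ ≤ ‖f k z‖ + ‖∑ j ∈ Finset.range k, a j * f k (x j)‖ := norm_sub_le _ _
    _ ≤ ‖z‖ + (2 ^ k - 1) * ‖z‖ := by gcongr
    _ = _ := by ring

/-- An operator that is not bounded below on any closed subspace of finite codimension is small on
some infinite-dimensional subspace. -/
theorem exists_infinite_dimensional_norm_le (T : X →L[𝕜] Y)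
    (hT : ∀ M : Submodule 𝕜 X, IsClosed (M : Set X) → M.CoFG → ∀ c : ℝ, 0 < c →
      ∃ x ∈ M, ‖T x‖ < c * ‖x‖) :
    ∃ Z : Submodule 𝕜 X, ¬ FiniteDimensional 𝕜 Z ∧ ∀ z ∈ Z, ‖T z‖ ≤ 1 / 2 * ‖z‖ := by
  -- Each new vector is taken in the common kernel of the earlier norming functionals, a closed
  -- subspace of finite codimension. The third entry is a counter whose strict growth forces `‖T uₙ‖
  -- ≤ 4^{-(n+1)}`.
  obtain ⟨u, hu, hr⟩ := exists_seq_of_forall_finset_exists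
    (fun p : X × StrongDual 𝕜 X × ℕ =>
      ‖p.1‖ ≤ 1 ∧ ‖p.2.1‖ ≤ 1 ∧ p.2.1 p.1 = 1 ∧ ‖T p.1‖ ≤ (1 / 4) ^ (p.2.2 + 1))
    (fun p q => p.2.1 q.1 = 0 ∧ p.2.2 < q.2.2) (by
      intro s _
      let g : X →L[𝕜] (s → 𝕜) := ContinuousLinearMap.pi fun p => p.1.2.1
      obtain ⟨n, hn⟩ : ∃ n, ∀ p ∈ s, p.2.2 < n :=
        ⟨s.sup (fun p => p.2.2) + 1, fun p hp =>
          Nat.lt_succ_of_le (Finset.le_sup (f := fun p : X × StrongDual 𝕜 X × ℕ => p.2.2) hp)⟩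
      have hco : g.ker.CoFG := by
        have : FiniteDimensional 𝕜 (X ⧸ g.toLinearMap.ker) :=
          g.toLinearMap.quotKerEquivRange.symm.finiteDimensional
        exact this
      obtain ⟨x, hxM, hx⟩ := hT g.ker g.isClosed_ker hco ((1 / 4) ^ (n + 1)) (by positivity)
      have hx0 : 0 < ‖x‖ := by
        by_contra h0
        have : ‖x‖ = 0 := le_antisymm (not_lt.1 h0) (norm_nonneg x)
        rw [this, mul_zero] at hx
        exact absurd hx (not_lt.2 (norm_nonneg _))
      obtain ⟨f, hf, hfx⟩ := exists_dual_vector'' 𝕜 x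
      have hxk : (‖x‖ : 𝕜) ≠ 0 := by exact_mod_cast hx0.ne'
      refine ⟨((‖x‖ : 𝕜)⁻¹ • x, f, n), ⟨?_, hf, ?_, ?_⟩, fun p hp => ⟨?_, hn p hp⟩⟩
      · simp [norm_smul, hx0.ne']
      · simp [hfx, hxk]
      · simp only [map_smul, norm_smul, norm_inv, RCLike.norm_ofReal, abs_norm]
        rw [inv_mul_le_iff₀ hx0, mul_comm]
        exact hx.le
      · have : g x = 0 := hxM
        have := congrFun this ⟨p, hp⟩
        simp only [g, ContinuousLinearMap.coe_pi', Pi.zero_apply] at this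
        simp [this])
  have hmono : StrictMono fun n => (u n).2.2 := fun m n hmn => (hr m n hmn).2
  have hTu : ∀ n, ‖T (u n).1‖ ≤ (1 / 4) ^ (n + 1) := fun n =>
    (hu n).2.2.2.trans (pow_le_pow_of_le_one (by norm_num) (by norm_num)
      (Nat.succ_le_succ (hmono.id_le n)))
  have hcoeff := norm_coeff_le_of_triangular (x := fun n => (u n).1) (f := fun n => (u n).2.1)
    (fun n => (hu n).1) (fun n => (hu n).2.1) (fun n => (hu n).2.2.1)
    (fun m n hmn => (hr m n hmn).1)
  have hli : LinearIndependent 𝕜 fun n => (u n).1 := by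
    rw [linearIndependent_iff']
    intro s a ha i hi
    obtain ⟨N, hN⟩ := s.exists_nat_subset_range
    have h0 : ∑ j ∈ Finset.range N, (if j ∈ s then a j else 0) • (u j).1 = 0 := by
      rw [← ha, ← Finset.sum_subset hN]
      · exact Finset.sum_congr rfl fun j hj => by simp [hj]
      · intro j _ hj
        simp [hj]
    have := hcoeff (fun j => if j ∈ s then a j else 0) N i (Finset.mem_range.1 (hN hi))
    rw [h0, norm_zero, mul_zero] at this
    simpa [hi] using this
  refine ⟨Submodule.span 𝕜 (Set.range fun n => (u n).1), fun hfin => ?_, fun z hz => ?_⟩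
  · have hli' := linearIndependent_span hli
    exact not_finite_iff_infinite.2 (inferInstanceAs (Infinite ℕ)) hli'.finite
  · obtain ⟨a, rfl⟩ := Finsupp.mem_span_range_iff_exists_finsupp.1 hz
    obtain ⟨N, hN⟩ := a.support.exists_nat_subset_range
    rw [Finsupp.sum_of_support_subset _ hN _ (by simp)]
    set z := ∑ j ∈ Finset.range N, a j • (u j).1 with hz
    -- The coefficient growth `2^j` is beaten by the decay `4^{-(j+1)}`; the geometric series sums
    -- to at most `1/2`.
    calc ‖T z‖ ≤ ∑ j ∈ Finset.range N, 1 / 4 * ‖z‖ * (1 / 2) ^ j := by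
          rw [show T z = ∑ j ∈ Finset.range N, T (a j • (u j).1) by rw [hz, map_sum]]
          refine norm_sum_le_of_le _ fun j hj => ?_
          rw [map_smul, norm_smul]
          calc ‖a j‖ * ‖T (u j).1‖ ≤ (2 ^ j * ‖z‖) * (1 / 4) ^ (j + 1) := by
                gcongr
                · exact hcoeff a N j (Finset.mem_range.1 hj)
                · exact hTu j
            _ = 1 / 4 * ‖z‖ * (2 * (1 / 4)) ^ j := by rw [mul_pow]; ring
            _ = _ := by norm_num
      _ = 1 / 4 * ‖z‖ * ∑ j ∈ Finset.range N, (1 / 2) ^ j := by rw [Finset.mul_sum]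
      _ ≤ 1 / 4 * ‖z‖ * 2 := by
          gcongr
          exact sum_geometric_two_le N
      _ = _ := by ring

/-- If `S` is strictly singular, then `1 - t S` is bounded below on a closed subspace of finite
codimension. -/
theorem IsStrictlySingular.exists_coFG_bddBelow {S : X →L[𝕜] X} (hS : IsStrictlySingular S)
    (t : 𝕜) : ∃ M : Submodule 𝕜 X, IsClosed (M : Set X) ∧ M.CoFG ∧
      ∃ c : ℝ, 0 < c ∧ ∀ x ∈ M, c * ‖x‖ ≤ ‖(1 - t • S) x‖ := by
  by_contra! hcon
  obtain ⟨Z, hZ, hsmall⟩ := exists_infinite_dimensional_norm_le (1 - t • S) hcon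
  -- On `Z`, `‖z‖ ≤ ‖z‖/2 + ‖t‖ ‖S z‖`; the `+ 1` covers `t = 0`.
  refine hZ (hS Z ⟨1 / (2 * (‖t‖ + 1)), by positivity, fun z hz => ?_⟩)
  have h1 : ‖z‖ ≤ ‖(1 - t • S) z‖ + ‖t‖ * ‖S z‖ := by
    rw [← norm_smul]
    calc ‖z‖ = ‖(1 - t • S) z + t • S z‖ := by simp
      _ ≤ _ := norm_add_le _ _
  have h2 := hsmall z hz
  rw [div_mul_eq_mul_div, one_mul, div_le_iff₀ (by positivity)]
  nlinarith [norm_nonneg (S z)]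

end StrictlySingular

/-! ### Compact perturbations of invertible operators -/

section CompactPerturbation

variable {𝕜 X : Type*} [RCLike 𝕜] [NormedAddCommGroup X] [NormedSpace 𝕜 X]

/-- The operators that become invertible after adding some compact operator. -/
def unitsAddCompact (𝕜 X : Type*) [RCLike 𝕜] [NormedAddCommGroup X]
    [NormedSpace 𝕜 X] :
    Set (X →L[𝕜] X) :=
  {A | ∃ K : X →L[𝕜] X, IsCompactOperator K ∧ IsUnit (A + K)}

theorem add_mem_unitsAddCompact {A K : X →L[𝕜] X} (hK : IsCompactOperator K)
    (hA : A ∈ unitsAddCompact 𝕜 X) : A + K ∈ unitsAddCompact 𝕜 X := by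
  obtain ⟨L, hL, hu⟩ := hA
  refine ⟨L - K, hL.sub hK, ?_⟩
  rwa [add_assoc, add_sub_cancel]

theorem add_mem_closure_unitsAddCompact {A K : X →L[𝕜] X} (hK : IsCompactOperator K)
    (hA : A ∈ closure (unitsAddCompact 𝕜 X)) : A + K ∈ closure (unitsAddCompact 𝕜 X) :=
  map_mem_closure (f := fun B => B + K) (by fun_prop) hA fun _ hB => add_mem_unitsAddCompact hK hB

variable [CompleteSpace X]

/-- An injective compact perturbation of the identity is invertible. -/
theorem isUnit_one_add_of_injective {K : X →L[𝕜] X} (hK : IsCompactOperator K)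
    (hinj : Function.Injective (1 + K : X →L[𝕜] X)) : IsUnit (1 + K) := by
  rcases hK.hasEigenvalue_or_mem_resolventSet (μ := (-1 : 𝕜)) (by simp) with h | h
  · obtain ⟨v, hv⟩ := h.exists_hasEigenvector
    have h1 : K v = (-1 : 𝕜) • v := hv.apply_eq_smul
    refine absurd (hinj (a₁ := v) (a₂ := 0) ?_) hv.2
    simp [h1]
  · rw [spectrum.mem_resolventSet_iff] at h
    have : 1 + K = -(algebraMap 𝕜 (X →L[𝕜] X) (-1) - K) := by simp [add_comm]
    rw [this]
    exact h.neg

/-- An injective compact perturbation of an invertible operator is invertible. -/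
theorem isUnit_of_injective_of_isUnit_add {A K : X →L[𝕜] X} (hK : IsCompactOperator K)
    (hu : IsUnit (A + K)) (hinj : Function.Injective A) : IsUnit A := by
  obtain ⟨u, hu⟩ := hu
  have hA : A = u * (1 + -((↑u⁻¹ : X →L[𝕜] X) * K)) := by
    rw [mul_add, mul_neg, ← mul_assoc, u.mul_inv, hu]
    simp
  have hc : IsCompactOperator (-((↑u⁻¹ : X →L[𝕜] X) * K)) :=
    (hK.clm_comp (↑u⁻¹ : X →L[𝕜] X)).neg
  rw [hA]
  refine u.isUnit.mul (isUnit_one_add_of_injective hc fun x y hxy => hinj ?_)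
  rw [hA]
  exact congrArg (u : X →L[𝕜] X) hxy

/-- A right invertible compact perturbation of an invertible operator is invertible. -/
theorem isUnit_of_mul_eq_one_of_isUnit_add {A K R : X →L[𝕜] X} (hK : IsCompactOperator K)
    (hu : IsUnit (A + K)) (hR : A * R = 1) : IsUnit A := by
  have hRinj : Function.Injective R := fun x y hxy => by
    have := congrArg A hxy
    rwa [← mul_apply_eq_comp, ← mul_apply_eq_comp, hR] at this
  obtain ⟨u, hu⟩ := hu
  have hc : IsCompactOperator (-((↑u⁻¹ : X →L[𝕜] X) * (K * R))) :=
    ((hK.comp_clm R).clm_comp (↑u⁻¹ : X →L[𝕜] X)).neg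
  -- `R` is injective and differs from `u⁻¹` by a compact operator, so the injective case applies to
  -- `R`.
  have hRu : R + -((↑u⁻¹ : X →L[𝕜] X) * (K * R)) = ↑u⁻¹ := by
    have : (u : X →L[𝕜] X) * R = 1 + K * R := by rw [hu, add_mul, hR]
    calc _ = (↑u⁻¹ : X →L[𝕜] X) * ((u : X →L[𝕜] X) * R - K * R) := by
          rw [mul_sub, ← mul_assoc (↑u⁻¹ : X →L[𝕜] X) (u : X →L[𝕜] X) R, u.inv_mul, one_mul,
            sub_eq_add_neg]
      _ = _ := by rw [this]; simp
  obtain ⟨r, rfl⟩ := isUnit_of_injective_of_isUnit_add hc (by rw [hRu]; exact u⁻¹.isUnit) hRinj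
  rw [Units.mul_eq_one_iff_eq_inv.1 hR]
  exact r⁻¹.isUnit

theorem isOpen_unitsAddCompact : IsOpen (unitsAddCompact 𝕜 X) := by
  have : unitsAddCompact 𝕜 X = ⋃ K ∈ {K : X →L[𝕜] X | IsCompactOperator K},
      (fun A => A + K) ⁻¹' {u | IsUnit u} := by
    ext A
    simp [unitsAddCompact]
  rw [this]
  exact isOpen_biUnion fun K _ => Units.isOpen.preimage (by fun_prop)

/-- A nearby member `B` of the set inherits the lower bound, so it is invertible by the Fredholm
alternative. Distance `c/3` leaves the bound `c/2`, whence `‖B⁻¹‖ ‖B - A‖ ≤ 2/3` and a Neumann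
series inverts `A`. -/
theorem isUnit_of_bddBelow_of_mem_closure {A : X →L[𝕜] X} {c : ℝ} (hc : 0 < c)
    (hA : ∀ x, c * ‖x‖ ≤ ‖A x‖) (hcl : A ∈ closure (unitsAddCompact 𝕜 X)) : IsUnit A := by
  obtain ⟨B, ⟨K, hK, hBK⟩, hB⟩ := Metric.mem_closure_iff.1 hcl (c / 3) (by positivity)
  rw [dist_eq_norm] at hB
  have hBx : ∀ x, c / 2 * ‖x‖ ≤ ‖B x‖ := fun x => by
    have h1 : ‖A x‖ ≤ ‖B x‖ + ‖(A - B) x‖ := by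
      calc ‖A x‖ = ‖B x + (A - B) x‖ := by simp
        _ ≤ _ := norm_add_le _ _
    have h2 : ‖(A - B) x‖ ≤ c / 3 * ‖x‖ := ((A - B).le_opNorm x).trans (by gcongr)
    nlinarith [hA x, norm_nonneg x, mul_nonneg hc.le (norm_nonneg x)]
  have hinj : Function.Injective B := by
    rw [injective_iff_map_eq_zero]
    intro x hx
    have := hBx x
    rw [hx, norm_zero] at this
    have h0 : ‖x‖ ≤ 0 := by
      by_contra h
      nlinarith
    exact norm_le_zero_iff.1 h0
  obtain ⟨u, rfl⟩ := isUnit_of_injective_of_isUnit_add hK hBK hinj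
  have hinv : ‖(↑u⁻¹ : X →L[𝕜] X)‖ ≤ 2 / c := by
    refine ContinuousLinearMap.opNorm_le_bound _ (by positivity) fun y => ?_
    have := hBx ((↑u⁻¹ : X →L[𝕜] X) y)
    rw [← mul_apply_eq_comp, u.mul_inv, one_apply_eq_self] at this
    rw [div_mul_eq_mul_div, le_div_iff₀ hc]
    linarith
  have hlt : ‖(↑u⁻¹ : X →L[𝕜] X) * (u - A)‖ < 1 := by
    calc _ ≤ ‖(↑u⁻¹ : X →L[𝕜] X)‖ * ‖(u : X →L[𝕜] X) - A‖ := norm_mul_le _ _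
      _ ≤ 2 / c * (c / 3) := by
          gcongr
          rw [norm_sub_rev]
          exact hB.le
      _ < 1 := by
          field_simp
          norm_num
  have hAu : A = u * (1 - (↑u⁻¹ : X →L[𝕜] X) * (u - A)) := by
    rw [mul_sub, ← mul_assoc, u.mul_inv]
    simp
  rw [hAu]
  exact u.isUnit.mul (isUnit_one_sub_of_norm_lt_one hlt)

/-- Since units are open, `B R` is a unit for some `B` in the set near `A`. Then `B` is right
invertible, hence invertible, and so are `R` and `A`. -/
theorem isUnit_of_mul_eq_one_of_mem_closure {A R : X →L[𝕜] X} (hR : A * R = 1)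
    (hcl : A ∈ closure (unitsAddCompact 𝕜 X)) : IsUnit A := by
  have hopen : IsOpen {B : X →L[𝕜] X | IsUnit (B * R)} :=
    Units.isOpen.preimage (f := fun B : X →L[𝕜] X => B * R) (by fun_prop)
  obtain ⟨B, ⟨v, hv⟩, K, hK, hBK⟩ := mem_closure_iff.1 hcl _ hopen (by simp [hR])
  have hB : B * (R * ↑v⁻¹) = 1 := by rw [← mul_assoc, ← hv, v.mul_inv]
  obtain ⟨w, rfl⟩ := isUnit_of_mul_eq_one_of_isUnit_add hK hBK hB
  have hRu : R = ↑(w⁻¹ * v) := by rw [Units.val_mul, hv, ← mul_assoc, w.inv_mul, one_mul]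
  rw [hRu] at hR
  rw [Units.mul_eq_one_iff_eq_inv.1 hR]
  exact Units.isUnit _

/-- An operator that is bounded below on a closed subspace of finite codimension is, up to a
compact operator, bounded below or right invertible. -/
theorem exists_compact_bddBelow_or_mul_eq_one {T : X →L[𝕜] X} {M : Submodule 𝕜 X}
    (hM : IsClosed (M : Set X)) (hMfin : M.CoFG) {c : ℝ} (hc : 0 < c)
    (hT : ∀ x ∈ M, c * ‖x‖ ≤ ‖T x‖) :
    ∃ F : X →L[𝕜] X, IsCompactOperator F ∧
      ((∃ d : ℝ, 0 < d ∧ ∀ x, d * ‖x‖ ≤ ‖(T + F) x‖) ∨ ∃ R, (T + F) * R = 1) := by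
  have : IsClosed (M : Set X) := hM
  have : FiniteDimensional 𝕜 (X ⧸ M) := hMfin
  have hTinj : ∀ x ∈ M, T x = 0 → x = 0 := fun x hx h0 => by
    have := hT x hx
    rw [h0, norm_zero] at this
    by_contra hne
    nlinarith [norm_pos_iff.2 hne]
  set N : Submodule 𝕜 X := M.map T.toLinearMap with hNdef
  have hN : IsClosed (N : Set X) := by
    have hanti : AntilipschitzWith (Real.toNNReal c⁻¹) (T ∘L M.subtypeL) :=
      ContinuousLinearMap.antilipschitz_of_bound _ fun x => by
        rw [Real.coe_toNNReal _ (by positivity), inv_mul_eq_div, le_div_iff₀ hc, mul_comm]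
        exact hT x x.2
    have : CompleteSpace M := hM.completeSpace_coe
    have := hanti.isClosed_range (T ∘L M.subtypeL).uniformContinuous
    convert this
    ext y
    simp [hNdef]
  let θ : (X ⧸ M) →ₗ[𝕜] (X ⧸ N) := M.mapQ N T.toLinearMap (Submodule.le_comap_map _ _)
  obtain ⟨ψ, hψ⟩ : ∃ ψ : (X ⧸ M) →ₗ[𝕜] (X ⧸ N),
      Function.Injective ψ ∨ Function.Surjective ψ := by
    -- Comparing cardinal ranks also covers `N` of infinite codimension.
    rcases le_total (Module.rank 𝕜 (X ⧸ M)) (Module.rank 𝕜 (X ⧸ N)) with h | h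
    · obtain ⟨ψ, hψ⟩ := rank_le_iff_exists_linearMap.1 h
      exact ⟨ψ, .inl hψ⟩
    · obtain ⟨φ, hφ⟩ := rank_le_iff_exists_linearMap.1 h
      obtain ⟨ψ, hψ⟩ := φ.exists_leftInverse_of_injective (LinearMap.ker_eq_bot.2 hφ)
      exact ⟨ψ, .inr fun y => ⟨φ y, LinearMap.congr_fun hψ y⟩⟩
  -- The correction `F` factors through the finite-dimensional `X ⧸ M`, so it is continuous and
  -- compact; it leaves `T` unchanged on `M` and replaces the induced quotient map `θ` by `ψ`.
  obtain ⟨J, hJ⟩ := Module.projective_lifting_property N.mkQ (ψ - θ) N.mkQ_surjective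
  let F : X →L[𝕜] X := J.toContinuousLinearMap ∘L M.mkQL
  have hF : IsCompactOperator F := by
    have : ProperSpace (X ⧸ M) := FiniteDimensional.proper_rclike 𝕜 _
    exact (isCompactOperator_of_locallyCompactSpace_rng J.toContinuousLinearMap).comp_clm M.mkQL
  have hFM : ∀ x ∈ M, (T + F) x = T x := fun x hx => by
    have : M.mkQ x = 0 := by simpa using hx
    simp [F, this]
  have hmk : ∀ x, N.mkQ ((T + F) x) = ψ (M.mkQ x) := fun x => by
    have h1 : N.mkQ (J (M.mkQ x)) = ψ (M.mkQ x) - θ (M.mkQ x) := LinearMap.congr_fun hJ _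
    have h2 : θ (M.mkQ x) = N.mkQ (T x) := rfl
    have h3 : (T + F) x = T x + J (M.mkQ x) := rfl
    rw [h3, map_add, h1, h2]
    abel
  refine ⟨F, hF, ?_⟩
  have hmapN : M.map (T + F).toLinearMap = N := by
    ext y
    simp only [hNdef, Submodule.mem_map]
    exact exists_congr fun x => and_congr_right fun hx => by
      rw [ContinuousLinearMap.coe_coe, hFM x hx, ContinuousLinearMap.coe_coe]
  rcases hψ with hψ | hψ
  · left
    have hinj : Function.Injective (T + F) := by
      rw [injective_iff_map_eq_zero]
      intro x hx
      have h1 := hmk x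
      rw [hx, map_zero] at h1
      have h2 : M.mkQ x = 0 := hψ (by rw [← h1, map_zero])
      have hxM : x ∈ M := by simpa using h2
      exact hTinj x hxM (by rw [← hFM x hxM, hx])
    have hclosed : IsClosed (Set.range (T + F)) := by
      have := (T + F).toLinearMap.isClosed_range_of_isClosed_map_of_finiteDimensional_quotient
        (s := M) (by rw [hmapN]; exact hN)
      exact this
    obtain ⟨K, hK⟩ := (T + F).antilipschitz_of_injective_of_isClosed_range hinj hclosed
    refine ⟨(K + 1 : ℝ)⁻¹, by positivity, fun x => ?_⟩
    rw [inv_mul_le_iff₀ (by positivity)]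
    have : ‖x‖ ≤ K * ‖(T + F) x‖ := by simpa using hK.le_mul_dist x 0
    nlinarith [norm_nonneg ((T + F) x)]
  · right
    have hsurj : Function.Surjective (T + F) := fun y => by
      obtain ⟨q, hq⟩ := hψ (N.mkQ y)
      obtain ⟨x, rfl⟩ := M.mkQ_surjective q
      have h1 : y - (T + F) x ∈ N := by
        rw [← Submodule.ker_mkQ N, LinearMap.mem_ker, map_sub, hmk, hq, sub_self]
      obtain ⟨m, hm, hmy⟩ := h1
      refine ⟨x + m, ?_⟩
      rw [map_add, hFM m hm]
      have : T m = y - (T + F) x := hmy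
      rw [this, add_sub_cancel]
    have hdisj : Disjoint (T + F).ker M := by
      rw [Submodule.disjoint_def]
      intro x hx hxM
      exact hTinj x hxM (by rw [← hFM x hxM]; exact hx)
    -- The kernel of `T + F` meets `M` trivially, so it has a closed complement `C`. Inverting `T +
    -- F` on `C` yields the right inverse.
    obtain ⟨C, hCclosed, hC⟩ :=
      (Submodule.ClosedComplemented.of_disjoint_of_finiteDimensional_quotient
        hM hdisj).exists_isClosed_isCompl
    have : CompleteSpace C := hCclosed.completeSpace_coe
    let G : C →L[𝕜] X := (T + F) ∘L C.subtypeL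
    have hGker : G.ker = ⊥ := by
      rw [Submodule.eq_bot_iff]
      intro x hx
      exact Subtype.ext (Submodule.disjoint_def.1 hC.disjoint x hx x.2)
    have hGrange : G.range = ⊤ := by
      rw [eq_top_iff]
      intro y _
      obtain ⟨x, rfl⟩ := hsurj y
      obtain ⟨k, hk, z, hz, rfl⟩ := Submodule.mem_sup.1
        (show x ∈ (T + F).ker ⊔ C by rw [hC.sup_eq_top]; trivial)
      refine ⟨⟨z, hz⟩, ?_⟩
      have : (T + F) k = 0 := hk
      rw [map_add, this, zero_add]
      rfl
    let e := ContinuousLinearEquiv.ofBijective G hGker hGrange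
    refine ⟨C.subtypeL ∘L (e.symm : X →L[𝕜] C), ?_⟩
    ext y
    exact ContinuousLinearEquiv.ofBijective_apply_symm_apply G hGker hGrange y

/-- An operator that is bounded below on a closed subspace of finite codimension and is a limit of
compact perturbations of invertible operators is itself such a perturbation. -/
theorem mem_unitsAddCompact_of_mem_closure {T : X →L[𝕜] X} {M : Submodule 𝕜 X}
    (hM : IsClosed (M : Set X)) (hMfin : M.CoFG) {c : ℝ} (hc : 0 < c)
    (hT : ∀ x ∈ M, c * ‖x‖ ≤ ‖T x‖) (hcl : T ∈ closure (unitsAddCompact 𝕜 X)) :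
    T ∈ unitsAddCompact 𝕜 X := by
  obtain ⟨F, hF, ⟨d, hd, hbelow⟩ | ⟨R, hR⟩⟩ :=
    exists_compact_bddBelow_or_mul_eq_one hM hMfin hc hT
  · exact ⟨F, hF, isUnit_of_bddBelow_of_mem_closure hd hbelow
      (add_mem_closure_unitsAddCompact hF hcl)⟩
  · exact ⟨F, hF, isUnit_of_mul_eq_one_of_mem_closure hR
      (add_mem_closure_unitsAddCompact hF hcl)⟩

/-- If `S` is strictly singular, then `1 - t S` is a compact perturbation of an invertible
operator. -/
theorem IsStrictlySingular.one_sub_smul_mem_unitsAddCompact {S : X →L[𝕜] X}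
    (hS : IsStrictlySingular S) (t : 𝕜) : 1 - t • S ∈ unitsAddCompact 𝕜 X := by
  have hcont : Continuous fun s : 𝕜 => (1 - s • S : X →L[𝕜] X) := by fun_prop
  -- Openness is that of the set of perturbed units; closedness uses the lower bound available at
  -- every `s`.
  have hclopen : IsClopen {s : 𝕜 | 1 - s • S ∈ unitsAddCompact 𝕜 X} := by
    refine ⟨closure_subset_iff_isClosed.1 fun s hs => ?_, isOpen_unitsAddCompact.preimage hcont⟩
    obtain ⟨M, hM, hMfin, c, hc, hbelow⟩ := hS.exists_coFG_bddBelow s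
    exact mem_unitsAddCompact_of_mem_closure hM hMfin hc hbelow
      (map_mem_closure (f := fun s : 𝕜 => (1 - s • S : X →L[𝕜] X)) hcont hs fun _ h => h)
  have huniv := hclopen.eq_univ ⟨0, 0, isCompactOperator_zero, by simp⟩
  exact huniv.ge (Set.mem_univ t)

/-- If `S` is strictly singular, then `1 - t S` is invertible in the Calkin algebra. -/
theorem IsStrictlySingular.isUnit_mk_one_sub_smul {S : X →L[𝕜] X} (hS : IsStrictlySingular S)
    (t : 𝕜) : IsUnit (1 - t • Ideal.Quotient.mk (compactIdeal 𝕜 X) S) := by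
  obtain ⟨K, hK, hu⟩ := hS.one_sub_smul_mem_unitsAddCompact t
  have := hu.map (Ideal.Quotient.mk (compactIdeal 𝕜 X))
  rw [map_add, Ideal.Quotient.eq_zero_iff_mem.2 ((mem_compactIdeal 𝕜 X).2 hK), add_zero] at this
  exact this

end CompactPerturbation

/-! ### Point evaluations on `ℓ₁(ℕ₀)` -/

namespace ConvL1

variable {𝕜 : Type*} [RCLike 𝕜]

theorem summable_norm_coord_mul_pow (a : ConvL1 𝕜) {x : 𝕜} (hx : ‖x‖ ≤ 1) :
    Summable fun n => ‖a.coord n * x ^ n‖ :=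
  a.summable_norm.of_nonneg_of_le (fun _ => norm_nonneg _) fun n => by
    rw [norm_mul, norm_pow]
    exact mul_le_of_le_one_right (norm_nonneg _) (pow_le_one₀ (norm_nonneg _) hx)

/-- The value at `x` of the power series with coefficients `a`. -/
noncomputable def eval (x : 𝕜) (a : ConvL1 𝕜) : 𝕜 := ∑' n, a.coord n * x ^ n

theorem hasSum_eval (a : ConvL1 𝕜) {x : 𝕜} (hx : ‖x‖ ≤ 1) :
    HasSum (fun n => a.coord n * x ^ n) (eval x a) :=
  (a.summable_norm_coord_mul_pow hx).of_norm.hasSum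

theorem eval_mul {x : 𝕜} (hx : ‖x‖ ≤ 1) (a b : ConvL1 𝕜) :
    eval x (a * b) = eval x a * eval x b := by
  unfold eval
  rw [tsum_mul_tsum_eq_tsum_sum_range_of_summable_norm (a.summable_norm_coord_mul_pow hx)
    (b.summable_norm_coord_mul_pow hx)]
  refine tsum_congr fun n => ?_
  rw [coord_mul, Finset.sum_mul]
  refine Finset.sum_congr rfl fun j hj => ?_
  have hn : j + (n - j) = n := Nat.add_sub_of_le (Nat.lt_succ_iff.1 (Finset.mem_range.1 hj))
  calc _ = a.coord j * b.coord (n - j) * x ^ (j + (n - j)) := by rw [hn]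
    _ = _ := by ring

theorem eval_one (x : 𝕜) : eval x (1 : ConvL1 𝕜) = 1 := by
  unfold eval
  rw [tsum_eq_single 0]
  · simp [coord_one]
  · intro n hn
    simp [coord_one, hn]

theorem eval_one_sub_smul {x : 𝕜} (hx : ‖x‖ ≤ 1) (t : 𝕜) (a : ConvL1 𝕜) :
    eval x (1 - t • a) = 1 - t * eval x a := by
  refine (hasSum_eval _ hx).unique ?_
  have h := (hasSum_eval 1 hx).sub ((hasSum_eval a hx).mul_left t)
  rw [eval_one] at h
  refine h.congr_fun fun n => ?_
  have : (1 - t • a).coord n = (1 : ConvL1 𝕜).coord n - t * a.coord n := rfl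
  rw [this]
  ring

/-- Uniqueness of power series coefficients at `0`, valid over both scalar fields. -/
theorem eq_zero_of_eval_eq_zero {a : ConvL1 𝕜} (h : ∀ x : 𝕜, ‖x‖ ≤ 1 → eval x a = 0) :
    a = 0 := by
  have hp : HasFPowerSeriesAt 0 (FormalMultilinearSeries.ofScalars 𝕜 a.coord) (0 : 𝕜) := by
    rw [hasFPowerSeriesAt_iff]
    filter_upwards [Metric.closedBall_mem_nhds (0 : 𝕜) one_pos] with x hx
    have hx' : ‖x‖ ≤ 1 := by simpa using hx
    have := hasSum_eval a hx'
    rw [h x hx'] at this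
    simpa [FormalMultilinearSeries.coeff_ofScalars, mul_comm] using this
  have h0 := hp.eq_zero
  ext n
  have := congrArg (fun p => FormalMultilinearSeries.coeff p n) h0
  rw [FormalMultilinearSeries.coeff_ofScalars] at this
  exact this

/-- An element `a` of `ℓ₁(ℕ₀)` for which every `1 - t a` is invertible vanishes. -/
theorem eq_zero_of_isUnit_one_sub_smul {a : ConvL1 𝕜} (h : ∀ t : 𝕜, IsUnit (1 - t • a)) :
    a = 0 := by
  refine eq_zero_of_eval_eq_zero fun x hx => ?_
  by_contra hne
  -- With this `t`, `1 - t a` evaluates to `0` at `x`, although it is a unit.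
  obtain ⟨b, hb⟩ := (h (eval x a)⁻¹).exists_right_inv
  have := congrArg (eval x) hb
  rw [eval_mul hx, eval_one_sub_smul hx, inv_mul_cancel₀ hne, sub_self, zero_mul, eval_one] at this
  exact zero_ne_one this

end ConvL1

/-! ### Strictly singular equals compact -/

theorem mainTheorem6 {𝕜 X : Type*} [RCLike 𝕜] [NormedAddCommGroup X] [NormedSpace 𝕜 X]
    [CompleteSpace X] (h : Nonempty (CalkinAlgebra 𝕜 X ≃A[𝕜] ConvL1 𝕜)) :
    ∀ T : X →L[𝕜] X, IsStrictlySingular T ↔ IsCompactOperator T := by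
  obtain ⟨e⟩ := h
  refine fun T => ⟨fun hT => ?_, fun hT => hT.isStrictlySingular⟩
  have hzero : e (Ideal.Quotient.mk (compactIdeal 𝕜 X) T) = 0 :=
    ConvL1.eq_zero_of_isUnit_one_sub_smul fun t => by
      have := (hT.isUnit_mk_one_sub_smul t).map e
      rwa [map_sub, map_one, map_smul] at this
  rw [← mem_compactIdeal, ← Ideal.Quotient.eq_zero_iff_mem]
  exact (map_eq_zero_iff e e.injective).1 hzero
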